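/- For finite sets $Q,R\subset\mathbb R\setminus\{0\}$ and a real $t>0$ put $\mathrm{Sym}_t^\times(Q,R)=\{x\in\mathbb R : |Q\cap xR^{-1}|\ge t\}$. For a finite nonempty set $A\subset\mathbb R\setminus\{0\}$ let $$d_*(A)=\min \frac{|Q|^2|R|^2}{|A|\,t^3},$$ where the minimum is over all real $t>0$ and all finite nonempty sets $Q,R\subset\mathbb R\setminus\{0\}$ such that $A\subseteq \mathrm{Sym}_t^\times(Q,R)$ and $\max\{|Q|,|R|\}\ge |A|$. A finite set $A\subset\mathbb R$ is said to be of Szemerédi–Trotter type with parameter $D>0$ if $$|\{s\in A-B : |A\cap(B+s)|\ge\tau\}|\le \frac{D|A||B|^2}{\tau^3}$$ for every finite set $B\subset\mathbb R$ and every real $\tau\ge1$. Then there is an absolute constant $C>0$ such that every finite nonempty set $A\subset\mathbb R\setminus\{0\}$ is of Szemerédi–Trotter type with parameter $C\,d_*(A)$. -/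

import Mathlib

/-!
Let `S` be the set of `s` with `|A ∩ (B + s)| ≥ τ`, and let every `a ∈ A` have at least `t`
representations `a = q r` with `q ∈ Q`, `r ∈ R`. Each `s ∈ S` can then be written in at least `τ t`
ways as `s = q r - b`, that is, at least `τ t` of the `|Q| |B|` lines `y = q x - b` meet the grid
`R × S` at height `s`. Hence there are at least `τ t |S|` incidences, and the Szemerédi–Trotter
theorem bounds `|S|`.

For a grid and lines of nonzero slope, Szemerédi–Trotter is elementary. Cut each side of the grid
into `r` blocks of consecutive elements. Lines are graphs of monotone functions, so each of them
visits at most `2 r` of the `r²` cells; a further incidence in a cell already visited yields two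
points of that cell on the line, and such a pair of points determines the line.
-/

open scoped Pointwise

noncomputable section

/-- The set `Sym_t^×(Q, R) = {x : |Q ∩ x R⁻¹| ≥ t}`. -/
def mulSym (t : ℝ) (Q R : Finset ℝ) : Set ℝ :=
  {x | t ≤ ((Q ∩ R.image (fun r => x * r⁻¹)).card : ℝ)}

/-- `(t, Q, R)` is admissible for `A`: `t > 0`, the sets `Q, R ⊂ ℝ ∖ {0}` are finite and nonempty,
`A ⊆ Sym_t^×(Q, R)` and `max {|Q|, |R|} ≥ |A|`. -/
structure MulSymAdmissible (A : Finset ℝ) (t : ℝ) (Q R : Finset ℝ) : Prop where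
  t_pos : 0 < t
  Q_nonempty : Q.Nonempty
  R_nonempty : R.Nonempty
  zero_notMem_Q : (0 : ℝ) ∉ Q
  zero_notMem_R : (0 : ℝ) ∉ R
  subset_mulSym : (A : Set ℝ) ⊆ mulSym t Q R
  card_le_max : A.card ≤ max Q.card R.card

/-- The set of all values `|Q|² |R|² / (|A| t³)` over the admissible `(t, Q, R)`. -/
def dStarValues (A : Finset ℝ) : Set ℝ :=
  {v | ∃ (t : ℝ) (Q R : Finset ℝ), MulSymAdmissible A t Q R ∧
    v = ((Q.card : ℝ) ^ 2 * (R.card : ℝ) ^ 2) / ((A.card : ℝ) * t ^ 3)}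

/-- The quantity `d_*(A)`, the minimum of `|Q|² |R|² / (|A| t³)` over the admissible `(t, Q, R)`.
It is meant for nonempty `A` with `0 ∉ A`. -/
def dStar (A : Finset ℝ) : ℝ := sInf (dStarValues A)

/-- A finite set `A` of reals is of Szemerédi–Trotter type with the parameter `D > 0` if
`|{s ∈ A - B : |A ∩ (B + s)| ≥ τ}| ≤ D |A| |B|² / τ³` for all finite `B` and all real `τ ≥ 1`. -/
def IsSzTType (A : Finset ℝ) (D : ℝ) : Prop :=
  0 < D ∧ ∀ (B : Finset ℝ) (τ : ℝ), 1 ≤ τ →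
    (({s ∈ A - B | τ ≤ ((A ∩ B.image (fun b => b + s)).card : ℝ)} : Finset ℝ).card : ℝ) ≤
      D * (A.card : ℝ) * (B.card : ℝ) ^ 2 / τ ^ 3

/-- The values are bounded below, so that the infimum in `dStar` is a genuine one. -/
theorem dStarValues_bddBelow (A : Finset ℝ) : BddBelow (dStarValues A) := by
  refine ⟨0, ?_⟩
  rintro v ⟨t, Q, R, h, rfl⟩
  have := h.t_pos
  positivity

/-- If `0 ∉ A` and `A` is nonempty then `Q = A`, `R = {1}`, `t = 1` is admissible. -/
theorem dStarValues_nonempty {A : Finset ℝ} (hA : A.Nonempty) (h0 : (0 : ℝ) ∉ A) :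
    (dStarValues A).Nonempty := by
  refine ⟨_, 1, A, {1}, ⟨one_pos, hA, Finset.singleton_nonempty _, h0, by simp, ?_, by simp⟩, rfl⟩
  intro x hx
  have hx' : x ∈ A := hx
  simp [mulSym, hx']

end

section Blocks

open Finset

variable {α β : Type*}

theorem strictMonoOn_card_filter_lt [LinearOrder α] (X : Finset α) :
    StrictMonoOn (fun x => #{z ∈ X | z < x}) X := by
  intro x hx y _ hxy
  refine card_lt_card <| (ssubset_iff_of_subset ?_).2 ⟨x, by simpa [hxy] using hx, by simp⟩
  exact monotone_filter_right X fun z _ hz => hz.trans hxy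

theorem card_filter_lt_lt_card [LinearOrder α] {X : Finset α} {x : α} (hx : x ∈ X) :
    #{z ∈ X | z < x} < #X :=
  card_lt_card <| filter_ssubset.2 ⟨x, hx, lt_irrefl x⟩

theorem exists_monotoneOn_card_fiber_le [LinearOrder α] (X : Finset α) {r : ℕ} (hr : 0 < r) :
    ∃ f : α → ℕ, MonotoneOn f X ∧ (∀ x ∈ X, f x < r) ∧ ∀ j, #{x ∈ X | f x = j} ≤ #X / r + 1 := by
  set k := #X / r + 1
  have hk : 0 < k := Nat.succ_pos _
  have hrank := strictMonoOn_card_filter_lt X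
  refine ⟨fun x => #{z ∈ X | z < x} / k,
    fun x hx y hy hxy => Nat.div_le_div_right (hrank.monotoneOn hx hy hxy), fun x hx => ?_,
    fun j => ?_⟩
  · rw [Nat.div_lt_iff_lt_mul hk]
    exact (card_filter_lt_lt_card hx).trans (Nat.lt_mul_div_succ _ hr)
  · calc #{x ∈ X | #{z ∈ X | z < x} / k = j} ≤ #(Ico (j * k) (j * k + k)) := by
          refine card_le_card_of_injOn (fun x => #{z ∈ X | z < x}) (fun x hx => ?_)
            (hrank.injOn.mono fun x hx => (mem_filter.1 hx).1)
          have hx := (Nat.div_eq_iff hk).1 (mem_filter.1 hx).2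
          simp only [coe_Ico, Set.mem_Ico]
          omega
      _ = k := by simp

theorem card_le_card_image_add_card_collisions [DecidableEq β] (P : Finset α) (φ : α → β) :
    #P ≤ #(P.image φ) + #{p ∈ P.offDiag | φ p.1 = φ p.2} := by
  have hfiber (b : β) : #{a ∈ P | φ a = b} ≤
      1 + #{p ∈ {p ∈ P.offDiag | φ p.1 = φ p.2} | φ p.1 = b} := by
    have hpairs : {p ∈ {p ∈ P.offDiag | φ p.1 = φ p.2} | φ p.1 = b} =
        ({a ∈ P | φ a = b} : Finset α).offDiag := by
      ext p
      simp only [mem_filter, mem_offDiag]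
      grind
    rw [hpairs, offDiag_card]
    rcases #{a ∈ P | φ a = b} with _ | n
    · exact Nat.zero_le _
    · calc n + 1 ≤ 1 + n * (n + 1) := by nlinarith
        _ = 1 + ((n + 1) * (n + 1) - (n + 1)) := by rw [← Nat.sub_one_mul, Nat.add_sub_cancel]
  calc #P = ∑ b ∈ P.image φ, #{a ∈ P | φ a = b} := card_eq_sum_card_image φ P
    _ ≤ ∑ b ∈ P.image φ, (1 + #{p ∈ {p ∈ P.offDiag | φ p.1 = φ p.2} | φ p.1 = b}) :=
        sum_le_sum fun b _ => hfiber b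
    _ = #(P.image φ) + #{p ∈ P.offDiag | φ p.1 = φ p.2} := by
        rw [sum_add_distrib, ← card_eq_sum_ones, ← card_eq_sum_card_fiberwise]
        intro p hp
        exact mem_image_of_mem φ (mem_offDiag.1 (mem_filter.1 hp).1).1

theorem card_filter_eq_le_card_mul [DecidableEq β] (X : Finset α) (f : α → β) {k : ℕ}
    (hk : ∀ b, #{x ∈ X | f x = b} ≤ k) :
    #{p ∈ X ×ˢ X | f p.1 = f p.2} ≤ #X * k := by
  classical
  rw [mul_comm]
  refine card_le_mul_card_image_of_maps_to (f := Prod.fst)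
    (fun p hp => (mem_product.1 (mem_filter.1 hp).1).1) k fun x _ => (hk (f x)).trans' ?_
  refine card_le_card_of_injOn Prod.snd (fun p hp => ?_) fun p hp q hq hpq => ?_
  · simp only [coe_filter, mem_filter, mem_product, Set.mem_ofPred_eq] at hp ⊢
    exact ⟨hp.1.1.2, hp.2 ▸ hp.1.2.symm⟩
  · exact Prod.ext ((mem_filter.1 hp).2.trans (mem_filter.1 hq).2.symm) hpq

variable [LinearOrder α] {X : Finset α} {f g : α → ℕ} {r s : ℕ}

theorem card_image_prodMk_le_of_monotoneOn (hf : MonotoneOn f X) (hg : MonotoneOn g X)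
    (hfr : ∀ x ∈ X, f x < r) (hgs : ∀ x ∈ X, g x < s) :
    #(X.image fun x => (f x, g x)) ≤ r + s := by
  rw [← card_range (r + s)]
  refine card_le_card_of_injOn (fun p => p.1 + p.2) ?_ ?_
  · simp only [Set.MapsTo, mem_coe, forall_mem_image, mem_range]
    exact fun x hx => Nat.add_lt_add (hfr x hx) (hgs x hx)
  · simp only [Set.InjOn, mem_coe, forall_mem_image, Prod.mk.injEq]
    intro x hx y hy hxy
    rcases le_total x y with h | h
    · have := hf hx hy h
      have := hg hx hy h
      omega
    · have := hf hy hx h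
      have := hg hy hx h
      omega

theorem card_image_prodMk_le_of_antitoneOn (hf : MonotoneOn f X) (hg : AntitoneOn g X)
    (hfr : ∀ x ∈ X, f x < r) (hgs : ∀ x ∈ X, g x < s) :
    #(X.image fun x => (f x, g x)) ≤ r + s := by
  have hreflect : X.image (fun x => (f x, g x)) =
      (X.image fun x => (f x, s - 1 - g x)).image fun p => (p.1, s - 1 - p.2) := by
    rw [image_image]
    refine image_congr fun x hx => Prod.ext rfl ?_
    exact (Nat.sub_sub_self (Nat.le_sub_one_of_lt (hgs x hx))).symm
  rw [hreflect]
  refine card_image_le.trans (card_image_prodMk_le_of_monotoneOn hf ?_ hfr fun x hx => ?_)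
  · exact fun x hx y hy hxy => Nat.sub_le_sub_left (hg hx hy hxy) _
  · have := hgs x hx
    omega

end Blocks

section Incidences

open Finset

variable {K : Type*} [Ring K]

theorem line_eq_of_two_points [NoZeroDivisors K] {m c m' c' x y : K} (hxy : x ≠ y)
    (hx : m * x + c = m' * x + c') (hy : m * y + c = m' * y + c') : (m, c) = (m', c') := by
  have hsub : m * (x - y) = m' * (x - y) := by
    simpa only [add_sub_add_right_eq_sub, ← mul_sub] using congrArg₂ (· - ·) hx hy
  obtain rfl : m = m' := mul_right_cancel₀ (sub_ne_zero.2 hxy) hsub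
  rw [add_left_cancel hx]

variable [DecidableEq K]

/-- The points of the grid `X × Y` on the line `y = m x + c`, where `l = (m, c)`. A point is
recorded by its abscissa alone; the encoding of lines leaves out the vertical ones. -/
def gridPointsOnLine (X Y : Finset K) (l : K × K) : Finset K :=
  {x ∈ X | l.1 * x + l.2 ∈ Y}

/-- The number of incidences between the grid `X × Y` and the lines `y = m x + c`, `(m, c) ∈ L`. -/
def gridIncidences (X Y : Finset K) (L : Finset (K × K)) : ℕ :=
  ∑ l ∈ L, #(gridPointsOnLine X Y l)

theorem gridIncidences_eq_sum_ordinates (X Y : Finset K) (L : Finset (K × K)) :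
    gridIncidences X Y L = ∑ y ∈ Y, ∑ l ∈ L, #{x ∈ X | l.1 * x + l.2 = y} := by
  rw [sum_comm]
  exact sum_congr rfl fun l _ => (sum_card_fiberwise_eq_card_filter X Y _).symm

theorem gridIncidences_le_card_left_mul (X Y : Finset K) (L : Finset (K × K)) :
    gridIncidences X Y L ≤ #X * #L := by
  rw [mul_comm]
  exact sum_le_card_nsmul _ _ _ fun l _ => card_filter_le _ _

variable [NoZeroDivisors K]

theorem gridIncidences_le_card_right_mul (X Y : Finset K) {L : Finset (K × K)}
    (hL : ∀ l ∈ L, l.1 ≠ 0) : gridIncidences X Y L ≤ #Y * #L := by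
  rw [mul_comm]
  refine sum_le_card_nsmul _ _ _ fun l hl => ?_
  exact card_le_card_of_injOn (fun x => l.1 * x + l.2) (fun x hx => (mem_filter.1 hx).2)
    fun x _ y _ h => mul_left_cancel₀ (hL l hl) (add_right_cancel h)

theorem sum_card_collisions_le {β γ : Type*} [DecidableEq β] [DecidableEq γ] (X Y : Finset K)
    (L : Finset (K × K)) (f : K → β) (g : K → γ) :
    ∑ l ∈ L, #{p ∈ (gridPointsOnLine X Y l).offDiag |
        (f p.1, g (l.1 * p.1 + l.2)) = (f p.2, g (l.1 * p.2 + l.2))} ≤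
      #{p ∈ X ×ˢ X | f p.1 = f p.2} * #{p ∈ Y ×ˢ Y | g p.1 = g p.2} := by
  rw [← card_sigma, ← card_product]
  refine card_le_card_of_injOn
    (fun p => (p.2, (p.1.1 * p.2.1 + p.1.2, p.1.1 * p.2.2 + p.1.2))) ?_ ?_
  · rintro ⟨l, p⟩ hp
    simp only [gridPointsOnLine, coe_sigma, Set.mem_sigma_iff, mem_coe, mem_filter, mem_offDiag,
      Prod.mk.injEq] at hp
    simp only [coe_product, Set.mem_prod, mem_coe, mem_filter, mem_product]
    tauto
  · rintro ⟨l, x, y⟩ hp ⟨l', x', y'⟩ - h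
    simp only [Prod.mk.injEq] at h
    obtain ⟨⟨rfl, rfl⟩, hx, hy⟩ := h
    have hxy : x ≠ y := (mem_offDiag.1 (mem_filter.1 (mem_sigma.1 hp).2).1).2.2
    obtain rfl : l = l' := line_eq_of_two_points hxy hx hy
    rfl

end Incidences

section GridPartition

open Finset

variable {K : Type*} [Ring K] [LinearOrder K] [IsStrictOrderedRing K]

theorem card_cells_on_line_le {X Y : Finset K} {f g : K → ℕ} {r s : ℕ} (hf : MonotoneOn f X)
    (hg : MonotoneOn g Y) (hfr : ∀ x ∈ X, f x < r) (hgs : ∀ y ∈ Y, g y < s) (l : K × K) :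
    #((gridPointsOnLine X Y l).image fun x => (f x, g (l.1 * x + l.2))) ≤ r + s := by
  have hX {x} (hx : x ∈ gridPointsOnLine X Y l) : x ∈ X := (mem_filter.1 hx).1
  have hY {x} (hx : x ∈ gridPointsOnLine X Y l) : l.1 * x + l.2 ∈ Y := (mem_filter.1 hx).2
  have hf' : MonotoneOn f (gridPointsOnLine X Y l) := hf.mono fun _ => hX
  rcases le_total 0 l.1 with hm | hm
  · refine card_image_prodMk_le_of_monotoneOn hf' (fun x hx y hy hxy => hg (hY hx) (hY hy) ?_)
      (fun x hx => hfr x (hX hx)) fun x hx => hgs _ (hY hx)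
    gcongr
  · refine card_image_prodMk_le_of_antitoneOn hf' (fun x hx y hy hxy => hg (hY hy) (hY hx) ?_)
      (fun x hx => hfr x (hX hx)) fun x hx => hgs _ (hY hx)
    exact add_le_add_left (mul_le_mul_of_nonpos_left hxy hm) _

theorem gridIncidences_le_of_blocks (X Y : Finset K) (L : Finset (K × K)) {r : ℕ} (hr : 0 < r) :
    gridIncidences X Y L ≤ 2 * r * #L + #X * (#X / r + 1) * (#Y * (#Y / r + 1)) := by
  obtain ⟨f, hf, hfr, hfk⟩ := exists_monotoneOn_card_fiber_le X hr
  obtain ⟨g, hg, hgr, hgk⟩ := exists_monotoneOn_card_fiber_le Y hr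
  calc gridIncidences X Y L
      ≤ ∑ l ∈ L, (2 * r + #{p ∈ (gridPointsOnLine X Y l).offDiag |
          (f p.1, g (l.1 * p.1 + l.2)) = (f p.2, g (l.1 * p.2 + l.2))}) := by
        refine sum_le_sum fun l _ => (card_le_card_image_add_card_collisions _ fun x =>
          (f x, g (l.1 * x + l.2))).trans (Nat.add_le_add_right ?_ _)
        exact (card_cells_on_line_le hf hg hfr hgr l).trans_eq (two_mul r).symm
    _ ≤ 2 * r * #L + #{p ∈ X ×ˢ X | f p.1 = f p.2} * #{p ∈ Y ×ˢ Y | g p.1 = g p.2} := by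
        rw [sum_add_distrib, sum_const, smul_eq_mul, mul_comm #L]
        exact Nat.add_le_add_left (sum_card_collisions_le X Y L f g) _
    _ ≤ 2 * r * #L + #X * (#X / r + 1) * (#Y * (#Y / r + 1)) := by
        gcongr
        · exact card_filter_eq_le_card_mul X f hfk
        · exact card_filter_eq_le_card_mul Y g hgk

theorem sq_mul_gridIncidences_le {X Y : Finset K} (L : Finset (K × K)) {r : ℕ} (hr : 0 < r)
    (hX : r ≤ #X) (hY : r ≤ #Y) :
    r ^ 2 * gridIncidences X Y L ≤ 2 * r ^ 3 * #L + 4 * (#X * #Y) ^ 2 := by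
  have hblock {n : ℕ} (hn : r ≤ n) : r * (n / r + 1) ≤ 2 * n := by
    linarith [Nat.mul_div_le n r]
  calc r ^ 2 * gridIncidences X Y L
      ≤ r ^ 2 * (2 * r * #L + #X * (#X / r + 1) * (#Y * (#Y / r + 1))) :=
        Nat.mul_le_mul_left _ (gridIncidences_le_of_blocks X Y L hr)
    _ = 2 * r ^ 3 * #L + #X * (r * (#X / r + 1)) * (#Y * (r * (#Y / r + 1))) := by ring
    _ ≤ 2 * r ^ 3 * #L + #X * (2 * #X) * (#Y * (2 * #Y)) :=
        Nat.add_le_add_left (Nat.mul_le_mul (Nat.mul_le_mul_left _ (hblock hX))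
          (Nat.mul_le_mul_left _ (hblock hY))) _
    _ = 2 * r ^ 3 * #L + 4 * (#X * #Y) ^ 2 := by ring

theorem gridIncidences_le_or_pow_three_le (X Y : Finset K) {L : Finset (K × K)}
    (hL : ∀ l ∈ L, l.1 ≠ 0) :
    gridIncidences X Y L ≤ 4 * #L ∨ gridIncidences X Y L ^ 3 ≤ 512 * (#X * #Y * #L) ^ 2 := by
  refine or_iff_not_imp_left.2 fun hlarge => ?_
  have hIX := gridIncidences_le_card_left_mul X Y L
  have hIY := gridIncidences_le_card_right_mul X Y hL
  have hblocks {r : ℕ} := sq_mul_gridIncidences_le (X := X) (Y := Y) L (r := r)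
  generalize gridIncidences X Y L = I at *
  have hLpos : 0 < 4 * #L := by
    refine Nat.pos_of_ne_zero fun h => hlarge ?_
    have : #L = 0 := by omega
    simpa [this] using hIX
  -- With this many blocks the main term `2 r |L|` is at most half of the incidences.
  set r := I / (4 * #L)
  have hr : 0 < r := Nat.div_pos (not_le.1 hlarge).le hLpos
  have hrI : r * (4 * #L) ≤ I := Nat.div_mul_le_self _ _
  have hIr : I ≤ 8 * #L * r := by
    have : I < 4 * #L * (r + 1) := Nat.lt_mul_div_succ _ hLpos
    nlinarith
  have hrX : r ≤ #X := Nat.div_le_of_le_mul (by linarith)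
  have hrY : r ≤ #Y := Nat.div_le_of_le_mul (by linarith)
  have hrsq : r ^ 2 * I ≤ 8 * (#X * #Y) ^ 2 := by
    have := hblocks hr hrX hrY
    have := Nat.mul_le_mul_left (r ^ 2) hrI
    linarith
  calc I ^ 3 = I ^ 2 * I := pow_succ I 2
    _ ≤ (8 * #L * r) ^ 2 * I := by gcongr
    _ = 64 * #L ^ 2 * (r ^ 2 * I) := by ring
    _ ≤ 64 * #L ^ 2 * (8 * (#X * #Y) ^ 2) := by gcongr
    _ = 512 * (#X * #Y * #L) ^ 2 := by ring

end GridPartition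

section Representations

open Finset

/-- The representations of `a` as a product `q r` with `q ∈ Q` and `r ∈ R`; in the absence of zeros
their number is `|Q ∩ a R⁻¹|`, but no inverses are needed. -/
def mulReps {M : Type*} [Mul M] [DecidableEq M] (Q R : Finset M) (a : M) : Finset (M × M) :=
  {p ∈ Q ×ˢ R | p.1 * p.2 = a}

theorem card_inter_image_mul_inv_le_card_mulReps {G₀ : Type*} [GroupWithZero G₀] [DecidableEq G₀]
    (Q : Finset G₀) {R : Finset G₀} (hR : 0 ∉ R) (a : G₀) :
    #(Q ∩ R.image fun r => a * r⁻¹) ≤ #(mulReps Q R a) := by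
  refine card_le_card_of_surjOn Prod.fst fun q hq => ?_
  obtain ⟨hq, hqR⟩ := mem_inter.1 hq
  obtain ⟨r, hr, rfl⟩ := mem_image.1 hqR
  have hr0 : r ≠ 0 := ne_of_mem_of_not_mem hr hR
  exact ⟨(a * r⁻¹, r), by simp [mulReps, hq, hr, hr0], rfl⟩

theorem card_mulReps_le_card_right {M₀ : Type*} [MonoidWithZero M₀] [IsRightCancelMulZero M₀]
    [DecidableEq M₀] (Q : Finset M₀) {R : Finset M₀} (hR : 0 ∉ R) (a : M₀) :
    #(mulReps Q R a) ≤ #R := by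
  refine card_le_card_of_injOn Prod.snd
    (fun p hp => (mem_product.1 (mem_filter.1 hp).1).2) fun p hp p' hp' h => ?_
  obtain ⟨hpQR, hpa⟩ := mem_filter.1 hp
  obtain ⟨-, hpa'⟩ := mem_filter.1 hp'
  have hr0 : p.2 ≠ 0 := ne_of_mem_of_not_mem (mem_product.1 hpQR).2 hR
  exact Prod.ext (mul_right_cancel₀ hr0 (hpa.trans (h ▸ hpa'.symm))) h

theorem sum_card_mulReps_le {M : Type*} [Mul M] [DecidableEq M] (A Q R : Finset M) :
    ∑ a ∈ A, #(mulReps Q R a) ≤ #Q * #R := by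
  rw [← card_product]
  exact (sum_card_fiberwise_eq_card_filter _ _ _).trans_le (card_filter_le _ _)

theorem card_mul_le_of_forall_le_card_mulReps {M : Type*} [Mul M] [DecidableEq M]
    {A Q R : Finset M} {t : ℝ} (hA : ∀ a ∈ A, t ≤ #(mulReps Q R a)) : #A * t ≤ #Q * #R := by
  calc #A * t = ∑ _a ∈ A, t := by rw [sum_const, nsmul_eq_mul]
    _ ≤ ∑ a ∈ A, (#(mulReps Q R a) : ℝ) := sum_le_sum hA
    _ ≤ #Q * #R := by exact_mod_cast sum_card_mulReps_le A Q R

theorem sum_card_mulReps_translate_le {K : Type*} [Ring K] [DecidableEq K] (A B Q R : Finset K)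
    (s : K) :
    ∑ a ∈ A ∩ B.image (fun b => b + s), #(mulReps Q R a) ≤
      ∑ l ∈ Q ×ˢ (-B), #{x ∈ R | l.1 * x + l.2 = s} := by
  have hreps (a : K) : #(mulReps Q R a) = ∑ q ∈ Q, #{x ∈ R | q * x = a} := by
    simp only [mulReps, card_filter, sum_product]
  calc ∑ a ∈ A ∩ B.image (fun b => b + s), #(mulReps Q R a)
      ≤ ∑ a ∈ B.image (fun b => b + s), #(mulReps Q R a) :=
        sum_le_sum_of_subset inter_subset_right
    _ = ∑ b ∈ B, ∑ q ∈ Q, #{x ∈ R | q * x = b + s} := by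
        simp only [sum_image (add_left_injective s).injOn, hreps]
    _ = ∑ l ∈ Q ×ˢ (-B), #{x ∈ R | l.1 * x + l.2 = s} := by
        simp only [sum_product_right, sum_neg_index, ← sub_eq_add_neg, sub_eq_iff_eq_add']

theorem mul_card_le_gridIncidences {K : Type*} [Ring K] [DecidableEq K] {A B Q R S : Finset K}
    {t τ : ℝ} (ht : 0 ≤ t) (hA : ∀ a ∈ A, t ≤ #(mulReps Q R a))
    (hS : ∀ s ∈ S, τ ≤ #(A ∩ B.image (fun b => b + s))) :
    τ * t * #S ≤ gridIncidences R S (Q ×ˢ (-B)) := by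
  have hheight (s : K) (hs : s ∈ S) :
      τ * t ≤ ∑ l ∈ Q ×ˢ (-B), (#{x ∈ R | l.1 * x + l.2 = s} : ℝ) := by
    calc τ * t ≤ #(A ∩ B.image fun b => b + s) * t := by gcongr; exact hS s hs
      _ = ∑ _a ∈ A ∩ B.image (fun b => b + s), t := by rw [sum_const, nsmul_eq_mul]
      _ ≤ ∑ a ∈ A ∩ B.image (fun b => b + s), (#(mulReps Q R a) : ℝ) :=
          sum_le_sum fun a ha => hA a (mem_inter.1 ha).1
      _ ≤ _ := by exact_mod_cast sum_card_mulReps_translate_le A B Q R s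
  rw [gridIncidences_eq_sum_ordinates, mul_comm, ← nsmul_eq_mul]
  push_cast
  exact card_nsmul_le_sum _ _ _ hheight

end Representations

section PopularDifferences

open Finset

variable {K : Type*} [Ring K] [LinearOrder K] [IsStrictOrderedRing K]
variable {A B Q R S : Finset K} {t τ : ℝ}

theorem card_popular_mul_pow_three_le (ht : 0 < t) (hτ : 0 < τ) (hQ : 0 ∉ Q) (hR : 0 ∉ R)
    (hA : ∀ a ∈ A, t ≤ #(mulReps Q R a))
    (hS : ∀ s ∈ S, τ ≤ #(A ∩ B.image (fun b => b + s))) :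
    #S * (τ * t) ^ 3 ≤ 512 * ((#Q : ℝ) * #R * #B) ^ 2 := by
  rcases S.eq_empty_or_nonempty with rfl | hSne
  · simp only [card_empty, Nat.cast_zero, zero_mul]
    positivity
  have hSpos : (0 : ℝ) < #S := by exact_mod_cast hSne.card_pos
  obtain ⟨s, hs⟩ := hSne
  have hτA : τ ≤ #A := (hS s hs).trans (by gcongr; exact inter_subset_left)
  have hτB : τ ≤ #B := (hS s hs).trans
    (by exact_mod_cast (card_le_card inter_subset_right).trans card_image_le)
  obtain ⟨a, ha⟩ : A.Nonempty := card_pos.1 (by exact_mod_cast hτ.trans_le hτA)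
  have htR : t ≤ #R := (hA a ha).trans (by exact_mod_cast card_mulReps_le_card_right Q hR a)
  have hτt : τ * t ≤ #Q * #R :=
    (mul_le_mul_of_nonneg_right hτA ht.le).trans (card_mul_le_of_forall_le_card_mulReps hA)
  have hlow := mul_card_le_gridIncidences ht.le hA hS
  have hslope : ∀ l ∈ Q ×ˢ (-B), l.1 ≠ 0 := fun l hl =>
    ne_of_mem_of_not_mem (mem_product.1 hl).1 hQ
  rcases gridIncidences_le_or_pow_three_le R S hslope with hI | hI <;>
    rw [card_product, card_neg] at hI
  · have hIS : τ * t * #S ≤ 4 * (#Q * #B) := hlow.trans (by exact_mod_cast hI)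
    calc #S * (τ * t) ^ 3 = τ * t * #S * ((τ * t) * (τ * t)) := by ring
      _ ≤ 4 * (#Q * #B) * ((#Q * #R) * (#B * #R)) := by gcongr
      _ ≤ 512 * (#Q * #R * #B) ^ 2 := by
          nlinarith [sq_nonneg ((#Q : ℝ) * #R * #B)]
  · have hIS : (τ * t * #S) ^ 3 ≤ 512 * (#R * #S * (#Q * #B) : ℝ) ^ 2 :=
      (pow_le_pow_left₀ (by positivity) hlow 3).trans (by exact_mod_cast hI)
    refine le_of_mul_le_mul_left ?_ (pow_pos hSpos 2)
    calc (#S : ℝ) ^ 2 * (#S * (τ * t) ^ 3) = (τ * t * #S : ℝ) ^ 3 := by ring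
      _ ≤ 512 * (#R * #S * (#Q * #B) : ℝ) ^ 2 := hIS
      _ = (#S : ℝ) ^ 2 * (512 * (#Q * #R * #B) ^ 2) := by ring

theorem lemma13_general (hAne : A.Nonempty) (ht : 0 < t) (hQ : 0 ∉ Q) (hR : 0 ∉ R)
    (hA : ∀ a ∈ A, t ≤ #(mulReps Q R a)) (B : Finset K) (hτ : 0 < τ) :
    (#{s ∈ A - B | τ ≤ #(A ∩ B.image (fun b => b + s))} : ℝ) ≤
      512 * ((#Q : ℝ) ^ 2 * #R ^ 2 / (#A * t ^ 3)) * #A * #B ^ 2 / τ ^ 3 := by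
  have : (#A : ℝ) ≠ 0 := by exact_mod_cast hAne.card_ne_zero
  have hbound := card_popular_mul_pow_three_le (B := B)
    (S := {s ∈ A - B | τ ≤ #(A ∩ B.image (fun b => b + s))}) ht hτ hQ hR hA
    fun s hs => (mem_filter.1 hs).2
  calc _ ≤ 512 * ((#Q : ℝ) * #R * #B) ^ 2 / (τ * t) ^ 3 := (le_div_iff₀ (by positivity)).2 hbound
    _ = _ := by field_simp

end PopularDifferences

section DStar

open Finset

theorem MulSymAdmissible.le_card_mulReps {A Q R : Finset ℝ} {t a : ℝ}
    (h : MulSymAdmissible A t Q R) (ha : a ∈ A) : t ≤ #(mulReps Q R a) :=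
  le_trans (h.subset_mulSym ha)
    (by exact_mod_cast card_inter_image_mul_inv_le_card_mulReps Q h.zero_notMem_R a)

theorem one_le_dStar {A : Finset ℝ} (hA : A.Nonempty) (h0 : (0 : ℝ) ∉ A) : 1 ≤ dStar A := by
  refine le_csInf (dStarValues_nonempty hA h0) ?_
  rintro _ ⟨t, Q, R, h, rfl⟩
  have hApos : (0 : ℝ) < #A := by exact_mod_cast hA.card_pos
  have ht := h.t_pos
  obtain ⟨a, ha⟩ := hA
  have hta : t ≤ #(Q ∩ R.image fun r => a * r⁻¹) := h.subset_mulSym ha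
  have htQ : t ≤ #Q := hta.trans (by gcongr; exact inter_subset_left)
  have htR : t ≤ #R := hta.trans
    (by exact_mod_cast (card_le_card inter_subset_right).trans card_image_le)
  have hAt : #A * t ≤ #Q * #R :=
    card_mul_le_of_forall_le_card_mulReps fun _ => h.le_card_mulReps
  rw [one_le_div (by positivity)]
  calc #A * t ^ 3 = (#A * t) * (t * t) := by ring
    _ ≤ (#Q * #R) * (#Q * #R) := by gcongr
    _ = (#Q : ℝ) ^ 2 * #R ^ 2 := by ring

theorem le_mul_sInf {V : Set ℝ} (hV : V.Nonempty) {a x : ℝ} (ha : 0 ≤ a)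
    (h : ∀ v ∈ V, x ≤ a * v) : x ≤ a * sInf V := by
  rw [← smul_eq_mul, ← Real.sInf_smul_of_nonneg ha]
  exact le_csInf hV.smul_set (Set.forall_mem_image.2 h)

theorem isSzTType_mul_dStar {A : Finset ℝ} {C : ℝ} (hC : 0 < C) (hA : A.Nonempty)
    (h0 : (0 : ℝ) ∉ A)
    (h : ∀ t Q R, MulSymAdmissible A t Q R → ∀ (B : Finset ℝ) (τ : ℝ), 1 ≤ τ →
      (#{s ∈ A - B | τ ≤ #(A ∩ B.image (fun b => b + s))} : ℝ) ≤
        C * ((#Q : ℝ) ^ 2 * #R ^ 2 / (#A * t ^ 3)) * #A * #B ^ 2 / τ ^ 3) :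
    IsSzTType A (C * dStar A) := by
  refine ⟨mul_pos hC (one_pos.trans_le (one_le_dStar hA h0)), fun B τ hτ => ?_⟩
  have hfactor (d : ℝ) : C * d * #A * #B ^ 2 / τ ^ 3 = C * #A * #B ^ 2 / τ ^ 3 * d := by ring
  rw [hfactor]
  refine le_mul_sInf (dStarValues_nonempty hA h0) (by positivity) ?_
  rintro _ ⟨t, Q, R, hadm, rfl⟩
  rw [← hfactor]
  exact h t Q R hadm B τ hτ

end DStar

theorem lemma13 :
    ∃ C : ℝ, 0 < C ∧ ∀ A : Finset ℝ, A.Nonempty → (0 : ℝ) ∉ A →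
      IsSzTType A (C * dStar A) := by
  refine ⟨512, by norm_num, fun A hA h0 =>
    isSzTType_mul_dStar (by norm_num) hA h0 fun t Q R h B τ hτ => ?_⟩
  exact lemma13_general hA h.t_pos h.zero_notMem_Q h.zero_notMem_R (fun _ => h.le_card_mulReps) B
    (one_pos.trans_le hτ)
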